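/- **Setting.** Let $\mathcal C\subseteq\mathbb R^d$ be a polytope (the convex hull of finitely many points) with vertex set $\mathrm{vert}(\mathcal C)$, diameter $\delta>0$ and pyramidal width $\omega>0$. Here $$\omega=\inf_{K,\,x,\,r}\ \min_{S}\ \max_{s\in K\cap \mathrm{vert}(\mathcal C),\ v\in S}\Big\langle \tfrac{r}{\|r\|_2},\,s-v\Big\rangle ,$$ where $K$ ranges over the nonempty faces of $\mathcal C$, $x$ over the points of $K$, $r$ over the nonzero vectors of $\mathrm{cone}(K-x)$, and $S$ over the sets $S\subseteq K\cap\mathrm{vert}(\mathcal C)$ such that $x$ is a convex combination of the elements of $S$ with all weights positive. Let $f\colon\mathcal C\to\mathbb R$ be convex and $C^1$ with gradient $\nabla f$, and $L$-smooth for some $L>0$, i.e. $f(y)\le f(x)+\langle\nabla f(x),y-x\rangle+\frac L2\|y-x\|_2^2$ for all $x,y\in\mathcal C$. Let $x^*\in\operatorname{argmin}_{\mathcal C} f$. Suppose that $f$ satisfies a $(\mu,\theta)$-Hölderian error bound for some $\mu>0$ and $\theta\in[0,1/2]$: for all $x\in\mathcal C$, $$\min_{z\in\operatorname{argmin}_{\mathcal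 C}f}\|x-z\|_2\le\mu\,(f(x)-f(x^*))^\theta \qquad(\text{with } 0^0=1).$$ Write $\eta_s=\frac4{s+4}$ for integers $s\ge-1$. **Algorithm (Away-Step Frank–Wolfe with the weakly open loop rule).** Choose $x_0\in\mathrm{vert}(\mathcal C)$ and set $S_0=\{x_0\}$, $\lambda_{x_0,0}=1$, $\ell_0=0$. For $t=0,1,2,\dots$: 1. Choose $p^{FW}_t\in\mathrm{vert}(\mathcal C)$ minimizing $\langle\nabla f(x_t),p-x_t\rangle$ over $p\in\mathcal C$, and $p^A_t\in S_t$ maximizing $\langle\nabla f(x_t),p-x_t\rangle$ over $p\in S_t$ (ties are broken arbitrarily). 2. If $\langle\nabla f(x_t),p_t^{FW}-x_t\rangle\le\langle\nabla f(x_t),x_t-p_t^A\rangle$ (Frank–Wolfe step), let $d_t=p_t^{FW}-x_t$ and $\eta_{t,\max}=1$. Otherwise (away step), let $d_t=x_t-p_t^A$ and $\eta_{t,\max}=\lambda_{p_t^A,t}/(1-\lambda_{p_t^A,t})$. Let $\gamma_t=\min\{\eta_{\ell_t},\eta_{t,\max}\}$ and $x_{t+1}=x_t+\gamma_td_t$.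 3. In a Frank–Wolfe step, set $\lambda_{p,t+1}=(1-\gamma_t)\lambda_{p,t}$ for $p\in S_t\setminus\{p_t^{FW}\}$. Set $\lambda_{p_t^{FW},t+1}=\gamma_t$ if $p_t^{FW}\notin S_t$, and $(1-\gamma_t)\lambda_{p_t^{FW},t}+\gamma_t$ if $p_t^{FW}\in S_t$. Set $S_{t+1}=S_t\cup\{p_t^{FW}\}$ if $\gamma_t<1$, and $\{p_t^{FW}\}$ if $\gamma_t=1$. In an away step, set $\lambda_{p,t+1}=(1+\gamma_t)\lambda_{p,t}$ for $p\in S_t\setminus\{p_t^A\}$ and $\lambda_{p_t^A,t+1}=(1+\gamma_t)\lambda_{p_t^A,t}-\gamma_t$. Set $S_{t+1}=S_t\setminus\{p_t^A\}$ if $\lambda_{p_t^A,t+1}=0$, and $S_{t+1}=S_t$ otherwise. 4. If $(\eta_{\ell_t}-\gamma_t)\langle\nabla f(x_t),p_t^A-p_t^{FW}\rangle\le(\eta_{\ell_t}^2-\gamma_t^2)L\delta^2$ (progress step), set $\ell_{t+1}=\ell_t+1$; otherwise set $\ell_{t+1}=\ell_t$. **Theorem.** For every run of this algorithm and every $t\ge1$,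 the primal gap $h_t=f(x_t)-f(x^*)$ satisfies $$h_t\le\max\left\{\eta_{\lceil t/2-2\rceil}^{1/(1-\theta)}\,\frac{L\delta^2}2,\ \left(\frac{\eta_{\lceil t/2-2\rceil}\,2\mu L\delta^2}{\omega}\right)^{1/(1-\theta)}+\eta_{\lceil t/2-2\rceil}^2\,\frac{L\delta^2}2\right\},$$ and consequently $h_t=\mathcal O\big(1/t^{1/(1-\theta)}\big)$ as $t\to\infty$. -/

import Mathlib

open Set Filter Topology Asymptotics

namespace AFW

/-- The space `ℝ^d` with the Euclidean norm. -/
abbrev E (d : ℕ) : Type := EuclideanSpace ℝ (Fin d)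

/-- A polytope: the convex hull of finitely many points. -/
def IsPolytope {d : ℕ} (C : Set (E d)) : Prop :=
  ∃ V : Set (E d), V.Finite ∧ C = convexHull ℝ V

/-- The set of vertices of a polytope. -/
def vertices {d : ℕ} (C : Set (E d)) : Set (E d) := C.extremePoints ℝ

/-! ### Pyramidal width -/

/-- `K` is a (nonempty) face of the convex set `C`. -/
structure IsFace {d : ℕ} (C K : Set (E d)) : Prop where
  nonempty : K.Nonempty
  convex : Convex ℝ K
  extreme : IsExtreme ℝ C K

/-- `S` is a finite set of atoms from `A` such that `x` is a proper convex combination of all the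
elements of `S`, that is, a convex combination in which every weight is positive. -/
def IsActiveSet {d : ℕ} (A : Set (E d)) (x : E d) (S : Finset (E d)) : Prop :=
  (S : Set (E d)) ⊆ A ∧
    ∃ w : E d → ℝ, (∀ v ∈ S, 0 < w v) ∧ ∑ v ∈ S, w v = 1 ∧ ∑ v ∈ S, w v • v = x

/-- The pyramidal directional width of the set of atoms `A` in direction `r` with base point `x`:
the minimum over all active sets `S` for `x` of
`max {⟪r / ‖r‖, s - v⟫ : s ∈ A, v ∈ S}`. -/
noncomputable def pyramidalDirWidth {d : ℕ} (A : Set (E d)) (r x : E d) : ℝ :=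
  sInf {m : ℝ | ∃ S : Finset (E d), IsActiveSet A x S ∧
    m = sSup {a : ℝ | ∃ s ∈ A, ∃ v ∈ S, a = inner ℝ (‖r‖⁻¹ • r) (s - v)}}

/-- `r` belongs to the cone generated by `K - x` and is nonzero (for convex `K` containing `x`). -/
def IsFeasibleDirection {d : ℕ} (K : Set (E d)) (x r : E d) : Prop :=
  r ≠ 0 ∧ ∃ a : ℝ, 0 ≤ a ∧ ∃ y ∈ K, r = a • (y - x)

/-- The pyramidal width of a polytope `C` with respect to its set of vertices: the infimum of the
pyramidal directional widths of `K ∩ vertices C` over all faces `K` of `C`, all base points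
`x ∈ K` and all nonzero directions `r` in the cone generated by `K - x`. -/
noncomputable def pyramidalWidth {d : ℕ} (C : Set (E d)) : ℝ :=
  sInf {m : ℝ | ∃ K : Set (E d), IsFace C K ∧ ∃ x ∈ K, ∃ r : E d,
    IsFeasibleDirection K x r ∧ m = pyramidalDirWidth (K ∩ vertices C) r x}

/-! ### Objective functions -/

/-- `f` is continuously differentiable over `C` with gradient `g`. -/
structure IsC1On {d : ℕ} (C : Set (E d)) (f : E d → ℝ) (g : E d → E d) : Prop where
  hasGradient : ∀ x ∈ C, HasGradientWithinAt f (g x) C x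
  continuousOn : ContinuousOn g C

/-- `f` is continuously differentiable over `C` with gradient `g`, and it is `L`-smooth over `C`. -/
structure IsSmoothOn {d : ℕ} (C : Set (E d)) (f : E d → ℝ) (g : E d → E d) (L : ℝ) : Prop where
  c1 : IsC1On C f g
  pos : 0 < L
  upper_bound : ∀ x ∈ C, ∀ y ∈ C,
    f y ≤ f x + inner ℝ (g x) (y - x) + L / 2 * ‖y - x‖ ^ 2

/-- The set of minimizers of `f` over `C`. -/
def minimizers {d : ℕ} (C : Set (E d)) (f : E d → ℝ) : Set (E d) :=
  {z | z ∈ C ∧ IsMinOn f C z}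

/-- The `(μ, θ)`-Hölderian error bound: the distance of every `x ∈ C` to the set of minimizers is
at most `μ * (f x - min f) ^ θ`. -/
def HolderErrorBound {d : ℕ} (C : Set (E d)) (f : E d → ℝ) (μ θ : ℝ) : Prop :=
  ∀ x ∈ C, ∀ z ∈ minimizers C f,
    Metric.infDist x (minimizers C f) ≤ μ * (f x - f z) ^ θ

/-! ### The algorithm -/

/-- The step-size rule `η_s = 4 / (s + 4)`, for integers `s`. -/
noncomputable def stepSize (s : ℤ) : ℝ := 4 / ((s : ℝ) + 4)

/-- The direction test: iteration with gradient `G` at the point `x`, with Frank-Wolfe vertex `p`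
and away vertex `q`, takes a Frank-Wolfe step (and an away step if the test fails). -/
def TakesFWStep {d : ℕ} (G x p q : E d) : Prop :=
  inner ℝ G (p - x) ≤ inner ℝ G (x - q)

open scoped Classical in
/-- `IsRun C g L δ η x S lam ℓ pFW pA γ` says that the sequences form a run of the Away-Step
Frank-Wolfe algorithm over `C`, for an objective with gradient `g`, with parameters `L`, `δ` and
step-size rule `η`. At iteration `t`: `x t` is the iterate, `S t` the active set, `lam t p` the
weight of `p ∈ S t`, `ℓ t` the number of progress steps made so far, `pFW t` and `pA t` the
Frank-Wolfe vertex and the away vertex (with arbitrary choices in case of ties), and `γ t` the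
step size that is used. -/
structure IsRun {d : ℕ} (C : Set (E d)) (g : E d → E d) (L δ : ℝ) (η : ℕ → ℝ)
    (x : ℕ → E d) (S : ℕ → Finset (E d)) (lam : ℕ → E d → ℝ) (ℓ : ℕ → ℕ)
    (pFW pA : ℕ → E d) (γ : ℕ → ℝ) : Prop where
  x_zero : x 0 ∈ vertices C
  S_zero : S 0 = {x 0}
  lam_zero : lam 0 (x 0) = 1
  ℓ_zero : ℓ 0 = 0
  pFW_mem : ∀ t, pFW t ∈ vertices C
  pFW_min : ∀ t, ∀ p ∈ C, inner ℝ (g (x t)) (pFW t - x t) ≤ inner ℝ (g (x t)) (p - x t)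
  pA_mem : ∀ t, pA t ∈ S t
  pA_max : ∀ t, ∀ p ∈ S t, inner ℝ (g (x t)) (p - x t) ≤ inner ℝ (g (x t)) (pA t - x t)
  fw_γ : ∀ t, TakesFWStep (g (x t)) (x t) (pFW t) (pA t) → γ t = min (η (ℓ t)) 1
  fw_x : ∀ t, TakesFWStep (g (x t)) (x t) (pFW t) (pA t) →
    x (t + 1) = x t + γ t • (pFW t - x t)
  fw_lam : ∀ t, TakesFWStep (g (x t)) (x t) (pFW t) (pA t) →
    ∀ p ∈ S t \ {pFW t}, lam (t + 1) p = (1 - γ t) * lam t p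
  fw_lam_pFW : ∀ t, TakesFWStep (g (x t)) (x t) (pFW t) (pA t) →
    lam (t + 1) (pFW t) =
      if pFW t ∈ S t then (1 - γ t) * lam t (pFW t) + γ t else γ t
  fw_S : ∀ t, TakesFWStep (g (x t)) (x t) (pFW t) (pA t) →
    S (t + 1) = if γ t < 1 then S t ∪ {pFW t} else {pFW t}
  away_γ : ∀ t, ¬ TakesFWStep (g (x t)) (x t) (pFW t) (pA t) →
    γ t = min (η (ℓ t)) (lam t (pA t) / (1 - lam t (pA t)))
  away_x : ∀ t, ¬ TakesFWStep (g (x t)) (x t) (pFW t) (pA t) →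
    x (t + 1) = x t + γ t • (x t - pA t)
  away_lam : ∀ t, ¬ TakesFWStep (g (x t)) (x t) (pFW t) (pA t) →
    ∀ p ∈ S t \ {pA t}, lam (t + 1) p = (1 + γ t) * lam t p
  away_lam_pA : ∀ t, ¬ TakesFWStep (g (x t)) (x t) (pFW t) (pA t) →
    lam (t + 1) (pA t) = (1 + γ t) * lam t (pA t) - γ t
  away_S : ∀ t, ¬ TakesFWStep (g (x t)) (x t) (pFW t) (pA t) →
    S (t + 1) = if lam (t + 1) (pA t) = 0 then S t \ {pA t} else S t
  ℓ_succ : ∀ t, ℓ (t + 1) =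
    if (η (ℓ t) - γ t) * inner ℝ (g (x t)) (pA t - pFW t) ≤
        (η (ℓ t) ^ 2 - γ t ^ 2) * L * δ ^ 2
      then ℓ t + 1 else ℓ t

end AFW

/-! Write `h` for the primal gap, `G = ⟪∇f(x), pA - pFW⟫`, `α = 1 / (1 - θ)`, `A = 2μLδ²/ω` and `H =
Lδ²/2`. Convexity and the scaling inequality `pyramidalWidth_mul_inner_le`, with `r = -∇f(x)`, give
`ω h ≤ G ‖x - y‖` for every minimizer `y`. By the error bound, `ω h ^ (1 - θ) ≤ μ G` when `h > 0`,
so `h > (η A) ^ α` forces `G > 2ηLδ²`.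

In a progress step, such a large `G` pays for the quadratic smoothness term and still contracts `h`
by `1 - η / 2`; below the threshold `h` grows by at most `η² H`. The test defining progress ensures
that every other step leaves `f` no larger (`step_cases`).

With `η = 4 / (P + 4)` after `P` progress steps, the contractions telescope to a decay like `1 / ((P
+ 2)(P + 3))`. Since `α ≤ 2`, this is at least as fast as the threshold decays, so the bound
attained just after the last visit below the threshold persists (`GapInvariant`). Finally, a step
without progress drops a vertex, and only progress steps add one, so `t ≤ 2 ℓ t`. -/

namespace AFW

variable {d : ℕ}

/-! ### Polytopes, pyramidal width and the scaling inequality -/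

lemma IsPolytope.convex {C : Set (E d)} (hC : IsPolytope C) : Convex ℝ C := by
  obtain ⟨V, -, rfl⟩ := hC
  exact convex_convexHull ℝ V

lemma IsPolytope.isCompact {C : Set (E d)} (hC : IsPolytope C) : IsCompact C := by
  obtain ⟨V, hV, rfl⟩ := hC
  exact hV.isCompact_convexHull ℝ

lemma IsPolytope.finite_vertices {C : Set (E d)} (hC : IsPolytope C) : (vertices C).Finite := by
  obtain ⟨V, hV, rfl⟩ := hC
  exact hV.subset extremePoints_convexHull_subset

lemma IsActiveSet.nonempty {A : Set (E d)} {x : E d} {S : Finset (E d)}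
    (hS : IsActiveSet A x S) : S.Nonempty := by
  obtain ⟨-, w, -, hw1, -⟩ := hS
  rw [Finset.nonempty_iff_ne_empty]
  rintro rfl
  simp at hw1

lemma pyramidalDirWidth_nonneg (A : Set (E d)) (r x : E d) : 0 ≤ pyramidalDirWidth A r x := by
  refine Real.sInf_nonneg ?_
  rintro m ⟨S, hS, rfl⟩
  obtain ⟨v, hv⟩ := hS.nonempty
  exact Real.sSup_nonneg' ⟨0, ⟨v, hS.1 hv, v, hv, by simp⟩, le_rfl⟩

lemma pyramidalWidth_nonneg (C : Set (E d)) : 0 ≤ pyramidalWidth C := by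
  refine Real.sInf_nonneg ?_
  rintro m ⟨K, -, x, -, r, -, rfl⟩
  exact pyramidalDirWidth_nonneg _ _ _

/-- The directional width of a face bounds the pyramidal width from above. -/
lemma pyramidalWidth_le {C K : Set (E d)} (hK : IsFace C K) {x r : E d} (hx : x ∈ K)
    (hr : IsFeasibleDirection K x r) :
    pyramidalWidth C ≤ pyramidalDirWidth (K ∩ vertices C) r x := by
  refine csInf_le ⟨0, ?_⟩ ⟨K, hK, x, hx, r, hr, rfl⟩
  rintro m ⟨K, -, x, -, r, -, rfl⟩
  exact pyramidalDirWidth_nonneg _ _ _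

lemma pyramidalDirWidth_le {A : Set (E d)} {r x : E d} {S : Finset (E d)} (hS : IsActiveSet A x S)
    {M : ℝ} (hM : ∀ s ∈ A, ∀ v ∈ S, inner ℝ r (s - v) ≤ M) :
    pyramidalDirWidth A r x ≤ ‖r‖⁻¹ * M := by
  have hbdd : BddBelow {m : ℝ | ∃ S : Finset (E d), IsActiveSet A x S ∧
      m = sSup {a : ℝ | ∃ s ∈ A, ∃ v ∈ S, a = inner ℝ (‖r‖⁻¹ • r) (s - v)}} := by
    refine ⟨0, ?_⟩
    rintro m ⟨S, hS, rfl⟩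
    obtain ⟨v, hv⟩ := hS.nonempty
    exact Real.sSup_nonneg' ⟨0, ⟨v, hS.1 hv, v, hv, by simp⟩, le_rfl⟩
  refine (csInf_le hbdd ⟨S, hS, rfl⟩).trans ?_
  obtain ⟨v, hv⟩ := hS.nonempty
  refine csSup_le ⟨0, v, hS.1 hv, v, hv, by simp⟩ ?_
  rintro a ⟨s, hs, v, hv, rfl⟩
  rw [real_inner_smul_left]
  exact mul_le_mul_of_nonneg_left (hM s hs v hv) (by positivity)

/-- An active set of a point of a face lies in that face. -/
lemma IsActiveSet.inner_eq {C : Set (E d)} {x q : E d} {S : Finset (E d)}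
    (hS : IsActiveSet (vertices C) x S) (hq : ∀ z ∈ C, inner ℝ q (z - x) ≤ 0) :
    ∀ v ∈ S, inner ℝ q (v - x) = 0 := by
  obtain ⟨hSA, w, hw, hw1, hwx⟩ := hS
  have hsum : ∑ v ∈ S, w v * inner ℝ q (v - x) = 0 := by
    have : ∑ v ∈ S, w v • (v - x) = 0 := by
      simp_rw [smul_sub, Finset.sum_sub_distrib, ← Finset.sum_smul, hw1, hwx, one_smul, sub_self]
    rw [← inner_zero_right (𝕜 := ℝ) q, ← this, inner_sum]
    simp_rw [real_inner_smul_right]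
  have hle : ∀ v ∈ S, w v * inner ℝ q (v - x) ≤ 0 := fun v hv =>
    mul_nonpos_of_nonneg_of_nonpos (hw v hv).le (hq v (extremePoints_subset (hSA hv)))
  intro v hv
  have := (Finset.sum_eq_zero_iff_of_nonpos hle).1 hsum v hv
  exact (mul_eq_zero.1 this).resolve_left (hw v hv).ne'

lemma isExposed_of_inner_le {C : Set (E d)} {q y : E d} (hy : y ∈ C)
    (hq : ∀ z ∈ C, inner ℝ q (z - y) ≤ 0) :
    IsExposed ℝ C {z ∈ C | inner ℝ q (z - y) = 0} := by
  intro _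
  refine ⟨innerSL ℝ q, ?_⟩
  ext z
  simp only [mem_ofPred_eq, innerSL_apply_apply, inner_sub_right] at hq ⊢
  refine and_congr_right fun hz => ⟨fun h w hw => ?_, fun h => ?_⟩
  · linarith [hq w hw]
  · linarith [hq z hz, h y hy]

/-- For a direction `r` and a point `x` of a polytope, `r` is the sum of a direction `p` that is
feasible at `x` and a normal `q` to the polytope at `x` which is orthogonal to `p`. -/
lemma exists_moreau_decomposition {C : Set (E d)} (hC : IsPolytope C) {x : E d} (hx : x ∈ C)
    (r : E d) :
    ∃ a : ℝ, 0 ≤ a ∧ ∃ y ∈ C, (∀ z ∈ C, inner ℝ (r - a • (y - x)) (z - x) ≤ 0) ∧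
      inner ℝ (r - a • (y - x)) (y - x) = 0 := by
  let τ : ℕ → ℝ := fun n => 1 / ((n : ℝ) + 1)
  have hτ : ∀ n, 0 < τ n := fun n => by positivity
  -- Project `x + τ n • r` onto `C` with `τ n → 0`; `F n` is the face exposed by the residual. Once
  -- `x` itself lies in `F n`, the residual is normal at `x` and orthogonal to `y n - x`, and
  -- dividing by `τ n` gives the decomposition.
  have hproj : ∀ n, ∃ y ∈ C, ∀ z ∈ C, inner ℝ (x + τ n • r - y) (z - y) ≤ 0 := by
    intro n
    obtain ⟨y, hy, h⟩ := exists_norm_eq_iInf_of_complete_convex ⟨x, hx⟩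
      hC.isCompact.isComplete hC.convex (x + τ n • r)
    exact ⟨y, hy, (norm_eq_iInf_iff_real_inner_le_zero hC.convex hy).1 h⟩
  choose y hyC hy using hproj
  let F : ℕ → Set (E d) := fun n => {z ∈ C | inner ℝ (x + τ n • r - y n) (z - y n) = 0}
  have hexp : ∀ n, IsExposed ℝ C (F n) := fun n => isExposed_of_inner_le (hyC n) (hy n)
  -- By Krein–Milman a face is determined by its vertices, so only finitely many faces occur among
  -- the `F n`.
  have hF : ∀ n, F n = closure (convexHull ℝ (F n ∩ vertices C)) := by
    intro n
    have h := closure_convexHull_extremePoints ((hexp n).isCompact hC.isCompact)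
      ((hexp n).convex hC.convex)
    rw [(hexp n).isExtreme.extremePoints_eq] at h
    exact h.symm
  have hlim : Tendsto y atTop (𝓝 x) := by
    have hb : ∀ n, ‖y n - x‖ ≤ τ n * ‖r‖ := by
      intro n
      have h1 := hy n x hx
      have h2 : inner ℝ (x + τ n • r - y n) (x - y n) =
          ‖y n - x‖ ^ 2 - τ n * inner ℝ r (y n - x) := by
        rw [← real_inner_self_eq_norm_sq, ← real_inner_smul_left, ← inner_sub_left,
          ← inner_neg_neg]
        congr 1 <;> abel
      have h3 := real_inner_le_norm r (y n - x)
      have h4 : ‖y n - x‖ ^ 2 ≤ τ n * (‖r‖ * ‖y n - x‖) := by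
        have := mul_le_mul_of_nonneg_left h3 (hτ n).le
        linarith
      by_contra! hlt
      have : 0 ≤ τ n * ‖r‖ := mul_nonneg (hτ n).le (norm_nonneg _)
      nlinarith
    rw [tendsto_iff_norm_sub_tendsto_zero]
    refine squeeze_zero (fun n => norm_nonneg _) hb ?_
    simpa [τ] using (tendsto_one_div_add_atTop_nhds_zero_nat (𝕜 := ℝ)).mul_const ‖r‖
  -- Pigeonhole: one closed face contains infinitely many `y n`, hence also their limit `x`.
  obtain ⟨n, hn⟩ : ∃ n, x ∈ F n := by
    have hfin : Finite (𝒫 (vertices C)) := hC.finite_vertices.finite_subsets.to_subtype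
    let T : ℕ → 𝒫 (vertices C) := fun n => ⟨F n ∩ vertices C, inter_subset_right⟩
    obtain ⟨T₀, hT₀⟩ := Finite.exists_infinite_fiber T
    have hinf : (T ⁻¹' {T₀}).Infinite := Set.infinite_coe_iff.1 hT₀
    have hfreq : ∃ᶠ n in atTop, y n ∈ closure (convexHull ℝ (T₀ : Set (E d))) := by
      refine (Nat.frequently_atTop_iff_infinite.2 hinf).mono fun n hn => ?_
      have : F n ∩ vertices C = T₀ := congrArg Subtype.val hn
      rw [← this, ← hF n]
      exact ⟨hyC n, by simp⟩
    have hxT := mem_closure_of_frequently_of_tendsto hfreq hlim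
    rw [closure_closure] at hxT
    obtain ⟨n, hn⟩ := hinf.nonempty
    have : F n ∩ vertices C = T₀ := congrArg Subtype.val hn
    rw [← this, ← hF n] at hxT
    exact ⟨n, hxT⟩
  have hn2 : inner ℝ (x + τ n • r - y n) (x - y n) = 0 := hn.2
  have hq : r - (τ n)⁻¹ • (y n - x) = (τ n)⁻¹ • (x + τ n • r - y n) := by
    rw [show x + τ n • r - y n = τ n • r - (y n - x) by abel, smul_sub _ (τ n • r), smul_smul,
      inv_mul_cancel₀ (hτ n).ne', one_smul]
  refine ⟨(τ n)⁻¹, (inv_pos.2 (hτ n)).le, y n, hyC n, fun z hz => ?_, ?_⟩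
  · rw [hq, real_inner_smul_left]
    refine mul_nonpos_of_nonneg_of_nonpos (inv_pos.2 (hτ n)).le ?_
    have := hy n z hz
    rw [inner_sub_right] at this hn2 ⊢
    linarith
  · rw [hq, real_inner_smul_left, ← neg_sub x (y n), inner_neg_right, hn2]
    simp

/-- The scaling inequality for the pyramidal width. -/
theorem pyramidalWidth_mul_inner_le {C : Set (E d)} (hC : IsPolytope C)
    {x r : E d} (hx : x ∈ C) {S : Finset (E d)} (hS : IsActiveSet (vertices C) x S) {M : ℝ}
    (hM : ∀ s ∈ C, ∀ v ∈ S, inner ℝ r (s - v) ≤ M) {y : E d} (hy : y ∈ C)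
    (hry : 0 < inner ℝ r (y - x)) :
    pyramidalWidth C * inner ℝ r (y - x) ≤ M * ‖y - x‖ := by
  obtain ⟨a, ha, u, hu, hq, hpq⟩ := exists_moreau_decomposition hC hx r
  set p := a • (u - x) with hp
  have hle : inner ℝ r (y - x) ≤ ‖p‖ * ‖y - x‖ := by
    have h1 := hq y hy
    rw [inner_sub_left] at h1
    linarith [real_inner_le_norm p (y - x)]
  have hp0 : 0 < ‖p‖ := by
    by_contra! h
    have h0 : ‖p‖ = 0 := le_antisymm h (norm_nonneg _)
    rw [h0, zero_mul] at hle
    linarith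
  -- The face cut out by the normal part `r - p` contains `x`, `S` and `u`. On it `r` and `p` agree
  -- on differences, so `M` also bounds the width in the feasible direction `p`.
  have hexp := isExposed_of_inner_le hx hq
  have hxK : x ∈ {z ∈ C | inner ℝ (r - p) (z - x) = 0} := ⟨hx, by simp⟩
  have hface : IsFace C {z ∈ C | inner ℝ (r - p) (z - x) = 0} :=
    ⟨⟨x, hxK⟩, hexp.convex hC.convex, hexp.isExtreme⟩
  have hSK := hS.inner_eq hq
  have hS' : IsActiveSet ({z ∈ C | inner ℝ (r - p) (z - x) = 0} ∩ vertices C) x S :=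
    ⟨fun v hv => ⟨⟨extremePoints_subset (hS.1 hv), hSK v hv⟩, hS.1 hv⟩, hS.2⟩
  have hw := pyramidalWidth_le hface hxK (r := p)
    ⟨norm_pos_iff.1 hp0, a, ha, u, ⟨hu, hpq⟩, hp⟩
  have hw2 : pyramidalWidth C ≤ ‖p‖⁻¹ * M := by
    refine hw.trans (pyramidalDirWidth_le hS' fun s hs v hv => ?_)
    have h1 : inner ℝ (r - p) (s - v) = 0 := by
      rw [← sub_sub_sub_cancel_right s v x, inner_sub_right, hs.1.2, hSK v hv, sub_zero]
    rw [inner_sub_left] at h1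
    linarith [hM s hs.1.1 v hv]
  rw [inv_mul_eq_div, le_div_iff₀ hp0] at hw2
  calc pyramidalWidth C * inner ℝ r (y - x) ≤ pyramidalWidth C * (‖p‖ * ‖y - x‖) :=
        mul_le_mul_of_nonneg_left hle (pyramidalWidth_nonneg C)
    _ = (pyramidalWidth C * ‖p‖) * ‖y - x‖ := by ring
    _ ≤ M * ‖y - x‖ := mul_le_mul_of_nonneg_right hw2 (norm_nonneg _)

/-- The first-order characterization of convexity, for a gradient within the set. -/
lemma inner_gradient_le_sub {C : Set (E d)} {f : E d → ℝ} (hf : ConvexOn ℝ C f) {x z G : E d}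
    (hx : x ∈ C) (hz : z ∈ C) (hG : HasGradientWithinAt f G C x) :
    inner ℝ G (z - x) ≤ f z - f x := by
  have hmem : ∀ s ∈ Icc (0 : ℝ) 1, x + s • (z - x) ∈ C := fun s hs =>
    hf.1.add_smul_sub_mem hx hz hs
  have hτ := tendsto_one_div_add_atTop_nhds_zero_nat (𝕜 := ℝ)
  have hI : ∀ n : ℕ, 1 / ((n : ℝ) + 1) ∈ Icc (0 : ℝ) 1 := fun n =>
    ⟨by positivity, by rw [div_le_one (by positivity)]; linarith [n.cast_nonneg (α := ℝ)]⟩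
  have hlim := hG.hasFDerivWithinAt.lim (l := atTop) (c := fun n : ℕ => (n : ℝ) + 1)
    (d := fun n : ℕ => (1 / ((n : ℝ) + 1)) • (z - x)) (v := z - x)
    (by simpa using hτ.smul_const (z - x))
    (Eventually.of_forall fun n => hmem _ (hI n))
    (by
      refine tendsto_const_nhds.congr fun n => ?_
      rw [smul_smul, mul_one_div_cancel (by positivity), one_smul])
  rw [InnerProductSpace.toDual_apply_apply] at hlim
  refine le_of_tendsto hlim (Eventually.of_forall fun n => ?_)
  have hn : (0 : ℝ) < n + 1 := by positivity
  have hc := hf.2 hx hz (sub_nonneg.2 (hI n).2) (hI n).1 (by ring)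
  have he : (1 - 1 / ((n : ℝ) + 1)) • x + (1 / ((n : ℝ) + 1)) • z =
      x + (1 / ((n : ℝ) + 1)) • (z - x) := by module
  rw [he] at hc
  simp only [smul_eq_mul] at hc ⊢
  calc ((n : ℝ) + 1) * (f (x + (1 / ((n : ℝ) + 1)) • (z - x)) - f x)
      ≤ ((n : ℝ) + 1) * ((1 / ((n : ℝ) + 1)) * (f z - f x)) := by gcongr; linarith
    _ = f z - f x := by field_simp

end AFW

/-! ### Weights of the active set and the count of progress steps -/

namespace AFW

variable {d : ℕ}

namespace IsRun

variable {C : Set (E d)} {g : E d → E d} {L δ : ℝ} {η : ℕ → ℝ} {x : ℕ → E d}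
  {S : ℕ → Finset (E d)} {lam : ℕ → E d → ℝ} {ℓ : ℕ → ℕ} {pFW pA : ℕ → E d} {γ : ℕ → ℝ}

lemma fw_γ_eq (h : IsRun C g L δ η x S lam ℓ pFW pA γ) (hη1 : ∀ n, η n ≤ 1) {t : ℕ}
    (hfw : TakesFWStep (g (x t)) (x t) (pFW t) (pA t)) : γ t = η (ℓ t) := by
  rw [h.fw_γ t hfw, min_eq_left (hη1 _)]

open scoped Classical in
-- The test function `φ` serves twice: `φ = 1` yields the total weight and `φ = id` the barycentre.
lemma sum_fw (h : IsRun C g L δ η x S lam ℓ pFW pA γ) (hη1 : ∀ n, η n ≤ 1) {t : ℕ}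
    (hfw : TakesFWStep (g (x t)) (x t) (pFW t) (pA t)) {M : Type*} [AddCommGroup M] [Module ℝ M]
    (φ : E d → M) :
    ∑ v ∈ S (t + 1), lam (t + 1) v • φ v =
      (1 - γ t) • ∑ v ∈ S t, lam t v • φ v + γ t • φ (pFW t) := by
  have hlam := h.fw_lam t hfw
  have hlamp := h.fw_lam_pFW t hfw
  have hS := h.fw_S t hfw
  have hγ1 : γ t ≤ 1 := by rw [h.fw_γ_eq hη1 hfw]; exact hη1 _
  have hsum : ∑ v ∈ S t \ {pFW t}, lam (t + 1) v • φ v =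
      (1 - γ t) • ∑ v ∈ S t \ {pFW t}, lam t v • φ v := by
    rw [Finset.smul_sum]
    exact Finset.sum_congr rfl fun v hv => by rw [hlam v (by simpa using hv), mul_smul]
  rcases hγ1.lt_or_eq with hlt | heq
  · rw [if_pos hlt] at hS
    have hS' : S (t + 1) = insert (pFW t) (S t \ {pFW t}) := by
      rw [hS]; ext v; by_cases hv : v = pFW t <;> simp [hv]
    rw [hS', Finset.sum_insert (by simp), hsum, hlamp]
    split_ifs with hp
    · rw [← Finset.sum_sdiff (Finset.singleton_subset_iff.2 hp), Finset.sum_singleton]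
      module
    · rw [Finset.sdiff_singleton_eq_erase, Finset.erase_eq_of_notMem hp]
      module
  · rw [if_neg heq.not_lt] at hS
    rw [hS, Finset.sum_singleton, hlamp, heq]
    simp

open scoped Classical in
lemma sum_away (h : IsRun C g L δ η x S lam ℓ pFW pA γ) {t : ℕ}
    (hfw : ¬ TakesFWStep (g (x t)) (x t) (pFW t) (pA t)) {M : Type*} [AddCommGroup M]
    [Module ℝ M] (φ : E d → M) :
    ∑ v ∈ S (t + 1), lam (t + 1) v • φ v =
      (1 + γ t) • ∑ v ∈ S t, lam t v • φ v - γ t • φ (pA t) := by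
  have hlam := h.away_lam t hfw
  have hlamp := h.away_lam_pA t hfw
  have hS := h.away_S t hfw
  have hpA := Finset.singleton_subset_iff.2 (h.pA_mem t)
  have hsum : ∑ v ∈ S t \ {pA t}, lam (t + 1) v • φ v =
      (1 + γ t) • ∑ v ∈ S t \ {pA t}, lam t v • φ v := by
    rw [Finset.smul_sum]
    exact Finset.sum_congr rfl fun v hv => by rw [hlam v (by simpa using hv), mul_smul]
  have key : ∑ v ∈ S t, lam (t + 1) v • φ v =
      (1 + γ t) • ∑ v ∈ S t, lam t v • φ v - γ t • φ (pA t) := by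
    rw [← Finset.sum_sdiff hpA, hsum, ← Finset.sum_sdiff hpA, Finset.sum_singleton,
      Finset.sum_singleton, hlamp]
    module
  rw [← key, hS]
  split_ifs with h0
  · rw [← Finset.sum_sdiff (s₂ := S t) hpA, Finset.sum_singleton, h0]
    simp
  · rfl

/-- The weights of the active set exhibit the iterate as a proper convex combination. -/
def HasWeights (C : Set (E d)) (x : ℕ → E d) (S : ℕ → Finset (E d)) (lam : ℕ → E d → ℝ)
    (t : ℕ) : Prop :=
  (S t : Set (E d)) ⊆ vertices C ∧ (∀ v ∈ S t, 0 < lam t v) ∧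
    ∑ v ∈ S t, lam t v = 1 ∧ ∑ v ∈ S t, lam t v • v = x t

lemma HasWeights.isActiveSet {t : ℕ} (hw : HasWeights C x S lam t) :
    IsActiveSet (vertices C) (x t) (S t) :=
  ⟨hw.1, lam t, hw.2⟩

lemma HasWeights.mem (hC : Convex ℝ C) {t : ℕ} (hw : HasWeights C x S lam t) : x t ∈ C := by
  obtain ⟨hS, hpos, h1, hx⟩ := hw
  rw [← hx]
  exact hC.sum_mem (fun v hv => (hpos v hv).le) h1 fun v hv => extremePoints_subset (hS hv)

lemma inner_gradient_pFW_nonpos (h : IsRun C g L δ η x S lam ℓ pFW pA γ) {t : ℕ}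
    (hx : x t ∈ C) : inner ℝ (g (x t)) (pFW t - x t) ≤ 0 := by
  simpa using h.pFW_min t (x t) hx

/-- The away vertex of an away step does not carry the whole weight. -/
lemma lam_pA_lt_one (h : IsRun C g L δ η x S lam ℓ pFW pA γ) (hC : Convex ℝ C) {t : ℕ}
    (hw : HasWeights C x S lam t)
    (hfw : ¬ TakesFWStep (g (x t)) (x t) (pFW t) (pA t)) : lam t (pA t) < 1 := by
  classical
  obtain ⟨hS, hpos, h1, hx⟩ := hw
  by_contra! hge
  have hpA := Finset.singleton_subset_iff.2 (h.pA_mem t)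
  have hsplit := Finset.sum_sdiff (f := lam t) hpA
  rw [Finset.sum_singleton, h1] at hsplit
  have hnn : ∀ v ∈ S t \ {pA t}, 0 ≤ lam t v := fun v hv =>
    (hpos v (Finset.sdiff_subset hv)).le
  have hz : ∑ v ∈ S t \ {pA t}, lam t v = 0 :=
    le_antisymm (by linarith) (Finset.sum_nonneg hnn)
  have hempty : S t \ {pA t} = ∅ := by
    rw [Finset.eq_empty_iff_forall_notMem]
    intro v hv
    exact (hpos v (Finset.sdiff_subset hv)).ne' ((Finset.sum_eq_zero_iff_of_nonneg hnn).1 hz v hv)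
  have hxA : x t = pA t := by
    rw [hz, zero_add] at hsplit
    rw [← hx, ← Finset.sum_sdiff hpA, hempty, Finset.sum_singleton, hsplit]
    simp
  -- With the whole weight on `pA t`, the iterate is `pA t`, and the direction test reads `⟪∇f, pFW
  -- - x⟫ ≤ 0`, which always holds.
  refine hfw ?_
  unfold TakesFWStep
  have := h.inner_gradient_pFW_nonpos (HasWeights.mem (lam := lam) hC ⟨hS, hpos, h1, hx⟩)
  rw [hxA] at this ⊢
  simpa using this

lemma γ_nonneg (h : IsRun C g L δ η x S lam ℓ pFW pA γ) (hC : Convex ℝ C)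
    (hη0 : ∀ n, 0 < η n) {t : ℕ} (hw : HasWeights C x S lam t) : 0 ≤ γ t := by
  by_cases hfw : TakesFWStep (g (x t)) (x t) (pFW t) (pA t)
  · rw [h.fw_γ t hfw]
    exact le_min (hη0 _).le zero_le_one
  · rw [h.away_γ t hfw]
    exact le_min (hη0 _).le (div_nonneg (hw.2.1 _ (h.pA_mem t)).le
      (sub_nonneg.2 (h.lam_pA_lt_one hC hw hfw).le))

lemma γ_le (h : IsRun C g L δ η x S lam ℓ pFW pA γ) (t : ℕ) : γ t ≤ η (ℓ t) := by
  by_cases hfw : TakesFWStep (g (x t)) (x t) (pFW t) (pA t)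
  · rw [h.fw_γ t hfw]
    exact min_le_left _ _
  · rw [h.away_γ t hfw]
    exact min_le_left _ _

lemma hasWeights_succ (h : IsRun C g L δ η x S lam ℓ pFW pA γ) (hC : Convex ℝ C)
    (hη0 : ∀ n, 0 < η n) (hη1 : ∀ n, η n ≤ 1) {t : ℕ} (hw : HasWeights C x S lam t) :
    HasWeights C x S lam (t + 1) := by
  classical
  have hγ0 := h.γ_nonneg hC hη0 hw
  have hw' := hw
  obtain ⟨hS, hpos, h1, hx⟩ := hw'
  by_cases hfw : TakesFWStep (g (x t)) (x t) (pFW t) (pA t)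
  · have hγ := h.fw_γ_eq hη1 hfw
    have hγpos : 0 < γ t := hγ ▸ hη0 _
    have hγ1 : γ t ≤ 1 := hγ ▸ hη1 _
    have hlamp : 0 < lam (t + 1) (pFW t) := by
      rw [h.fw_lam_pFW t hfw]
      split_ifs with hp
      · have := mul_nonneg (sub_nonneg.2 hγ1) (hpos _ hp).le
        linarith
      · exact hγpos
    have hsub : ∀ v ∈ S (t + 1), v = pFW t ∨ (γ t < 1 ∧ v ∈ S t) := by
      intro v hv
      rw [h.fw_S t hfw] at hv
      split_ifs at hv with hlt
      · simp only [Finset.mem_union, Finset.mem_singleton] at hv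
        tauto
      · exact Or.inl (by simpa using hv)
    refine ⟨fun v hv => ?_, fun v hv => ?_, ?_, ?_⟩
    · rcases hsub v hv with rfl | ⟨-, hv⟩
      exacts [h.pFW_mem t, hS hv]
    · rcases hsub v hv with rfl | ⟨hlt, hv⟩
      · exact hlamp
      · by_cases hvp : v = pFW t
        · exact hvp ▸ hlamp
        · rw [h.fw_lam t hfw v (by simp [hv, hvp])]
          exact mul_pos (sub_pos.2 hlt) (hpos v hv)
    · have := h.sum_fw hη1 hfw (fun _ => (1 : ℝ))
      simp only [smul_eq_mul, mul_one] at this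
      rw [this, h1]
      ring
    · rw [h.sum_fw hη1 hfw (fun v => v), hx, h.fw_x t hfw]
      module
  · have hlt := h.lam_pA_lt_one hC hw hfw
    have hlamp : 0 ≤ lam (t + 1) (pA t) := by
      have hle : γ t ≤ lam t (pA t) / (1 - lam t (pA t)) := by
        rw [h.away_γ t hfw]
        exact min_le_right _ _
      rw [le_div_iff₀ (sub_pos.2 hlt)] at hle
      rw [h.away_lam_pA t hfw]
      linarith
    have hsub : ∀ v ∈ S (t + 1), v ∈ S t ∧ (v = pA t → lam (t + 1) (pA t) ≠ 0) := by
      intro v hv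
      rw [h.away_S t hfw] at hv
      split_ifs at hv with h0
      · simp only [Finset.mem_sdiff, Finset.mem_singleton] at hv
        tauto
      · exact ⟨hv, fun _ => h0⟩
    refine ⟨fun v hv => hS (hsub v hv).1, fun v hv => ?_, ?_, ?_⟩
    · obtain ⟨hvS, hvp⟩ := hsub v hv
      by_cases hv' : v = pA t
      · rw [hv']
        exact lt_of_le_of_ne hlamp (hvp hv').symm
      · rw [h.away_lam t hfw v (by simp [hvS, hv'])]
        exact mul_pos (by linarith) (hpos v hvS)
    · have := h.sum_away hfw (fun _ => (1 : ℝ))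
      simp only [smul_eq_mul, mul_one] at this
      rw [this, h1]
      ring
    · rw [h.sum_away hfw (fun v => v), hx, h.away_x t hfw]
      module

lemma hasWeights (h : IsRun C g L δ η x S lam ℓ pFW pA γ) (hC : Convex ℝ C)
    (hη0 : ∀ n, 0 < η n) (hη1 : ∀ n, η n ≤ 1) (t : ℕ) : HasWeights C x S lam t := by
  induction t with
  | zero =>
    refine ⟨?_, ?_, ?_, ?_⟩ <;> rw [h.S_zero]
    · simpa using h.x_zero
    · simp [h.lam_zero]
    · simp [h.lam_zero]
    · simp [h.lam_zero]
  | succ t ih => exact h.hasWeights_succ hC hη0 hη1 ih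

/-- A step that is not shortened is a progress step. -/
lemma ℓ_succ_of_γ_eq (h : IsRun C g L δ η x S lam ℓ pFW pA γ) {t : ℕ} (hγ : γ t = η (ℓ t)) :
    ℓ (t + 1) = ℓ t + 1 := by
  rw [h.ℓ_succ t, if_pos]
  simp [hγ]

/-- At least every other step is a progress step, since the other steps remove a vertex from the
active set. -/
lemma card_add_le (h : IsRun C g L δ η x S lam ℓ pFW pA γ) (hC : Convex ℝ C)
    (hη0 : ∀ n, 0 < η n) (hη1 : ∀ n, η n ≤ 1) (t : ℕ) : (S t).card + t ≤ 2 * ℓ t + 1 := by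
  classical
  induction t with
  | zero => simp [h.S_zero, h.ℓ_zero]
  | succ t ih =>
    have hw := h.hasWeights hC hη0 hη1 t
    by_cases hfw : TakesFWStep (g (x t)) (x t) (pFW t) (pA t)
    · have hℓ := h.ℓ_succ_of_γ_eq (h.fw_γ_eq hη1 hfw)
      have hcard : (S (t + 1)).card ≤ (S t).card + 1 := by
        rw [h.fw_S t hfw]
        split_ifs
        · exact (Finset.card_union_le _ _).trans (by simp)
        · simp
      omega
    · have hS := h.away_S t hfw
      by_cases hγ : γ t = η (ℓ t)
      · have hℓ := h.ℓ_succ_of_γ_eq hγ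
        have hcard : (S (t + 1)).card ≤ (S t).card := by
          rw [hS]
          split_ifs
          · exact Finset.card_le_card Finset.sdiff_subset
          · exact le_rfl
        omega
      · have hlt := h.lam_pA_lt_one hC hw hfw
        have hγ' : γ t = lam t (pA t) / (1 - lam t (pA t)) := by
          have := h.away_γ t hfw
          rcases min_choice (η (ℓ t)) (lam t (pA t) / (1 - lam t (pA t))) with h' | h'
          · exact absurd (this.trans h') hγ
          · exact this.trans h'
        -- The maximal away step `λ / (1 - λ)` is exactly the one that makes the new weight `(1 + γ)
        -- λ - γ` vanish.
        have h0 : lam (t + 1) (pA t) = 0 := by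
          rw [h.away_lam_pA t hfw]
          have : γ t * (1 - lam t (pA t)) = lam t (pA t) := by
            rw [hγ', div_mul_cancel₀ _ (sub_pos.2 hlt).ne']
          linarith
        rw [if_pos h0] at hS
        have hcard : (S (t + 1)).card + 1 = (S t).card := by
          rw [hS, Finset.sdiff_singleton_eq_erase]
          exact Finset.card_erase_add_one (h.pA_mem t)
        have hℓ : ℓ t ≤ ℓ (t + 1) := by
          rw [h.ℓ_succ t]
          split_ifs <;> omega
        omega

lemma le_two_mul_ℓ (h : IsRun C g L δ η x S lam ℓ pFW pA γ) (hC : Convex ℝ C)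
    (hη0 : ∀ n, 0 < η n) (hη1 : ∀ n, η n ≤ 1) (t : ℕ) : t ≤ 2 * ℓ t := by
  have h1 := h.card_add_le hC hη0 hη1 t
  have h2 : 0 < (S t).card := Finset.card_pos.2 ⟨_, h.pA_mem t⟩
  omega

end IsRun

end AFW

/-! ### Step sizes, the gap recursion and the convergence rate -/

namespace AFW

variable {d : ℕ}

lemma stepSize_natCast (n : ℕ) : stepSize (n : ℤ) = 4 / ((n : ℝ) + 4) := by
  simp [stepSize]

lemma stepSize_pos {s : ℤ} (hs : -1 ≤ s) : 0 < stepSize s := by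
  have : (-1 : ℝ) ≤ s := by exact_mod_cast hs
  exact div_pos (by norm_num) (by linarith)

lemma stepSize_natCast_le_one (n : ℕ) : stepSize (n : ℤ) ≤ 1 := by
  rw [stepSize_natCast, div_le_one (by positivity)]
  linarith [n.cast_nonneg (α := ℝ)]

lemma stepSize_anti {s s' : ℤ} (hs : -1 ≤ s) (h : s ≤ s') : stepSize s' ≤ stepSize s := by
  have h1 : (-1 : ℝ) ≤ s := by exact_mod_cast hs
  have h2 : (s : ℝ) ≤ s' := by exact_mod_cast h
  exact div_le_div_of_nonneg_left (by norm_num) (by linarith) (by linarith)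

/-! ### A recursion for the primal gap -/

/-- The envelope of the primal gap as a function of the step size. -/
noncomputable def rateBound (α A H e : ℝ) : ℝ :=
  max (e ^ α * H) ((e * A) ^ α + e ^ 2 * H)

lemma rateBound_mono {α A H e e' : ℝ} (hα : 0 ≤ α) (hA : 0 ≤ A) (hH : 0 ≤ H) (he : 0 ≤ e)
    (hee : e ≤ e') : rateBound α A H e ≤ rateBound α A H e' := by
  unfold rateBound
  gcongr

/-- The invariant of the recursion after `P` progress steps: `h` has decreased like
`1 / ((P + 2) * (P + 3))`, either since the first step or since the last step at which it was
below the threshold `(η_k * A) ^ α`. -/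
def GapInvariant (α A H : ℝ) (P : ℕ) (h : ℝ) : Prop :=
  h * ((P + 2) * (P + 3)) ≤ 12 * H ∨
    ∃ k : ℕ, k + 1 ≤ P ∧ h * ((P + 2) * (P + 3)) ≤
      (k + 3) * (k + 4) * ((4 / ((k : ℝ) + 4) * A) ^ α + (4 / ((k : ℝ) + 4)) ^ 2 * H)

lemma GapInvariant.mono {α A H : ℝ} {P : ℕ} {h h' : ℝ} (hi : GapInvariant α A H P h)
    (hle : h' ≤ h) : GapInvariant α A H P h' := by
  have h1 : h' * (((P : ℝ) + 2) * (P + 3)) ≤ h * ((P + 2) * (P + 3)) := by gcongr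
  rcases hi with hi | ⟨k, hk, hi⟩
  exacts [Or.inl (h1.trans hi), Or.inr ⟨k, hk, h1.trans hi⟩]

/-- Above the threshold the contraction factor is `(P + 2) / (P + 4)`, so the product of `h` with
`(P + 2)(P + 3)` does not increase. Otherwise the record restarts at `k = P`. -/
lemma GapInvariant.succ {α A H : ℝ} {P : ℕ} {h h' : ℝ} (hi : GapInvariant α A H P h)
    (hstep : h' ≤ h + (4 / ((P : ℝ) + 4)) ^ 2 * H)
    (hcontr : (4 / ((P : ℝ) + 4) * A) ^ α < h → h' ≤ (1 - 4 / ((P : ℝ) + 4) / 2) * h) :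
    GapInvariant α A H (P + 1) h' := by
  by_cases hc : (4 / ((P : ℝ) + 4) * A) ^ α < h
  · have h1 : h' * (((P + 1 : ℕ) + 2 : ℝ) * ((P + 1 : ℕ) + 3)) ≤ h * ((P + 2) * (P + 3)) := by
      calc h' * (((P + 1 : ℕ) + 2 : ℝ) * ((P + 1 : ℕ) + 3))
          ≤ ((1 - 4 / ((P : ℝ) + 4) / 2) * h) * (((P + 1 : ℕ) + 2 : ℝ) * ((P + 1 : ℕ) + 3)) :=
            mul_le_mul_of_nonneg_right (hcontr hc) (by positivity)
        _ = h * ((P + 2) * (P + 3)) := by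
            push_cast
            field_simp
            ring
    rcases hi with hi | ⟨k, hk, hi⟩
    exacts [Or.inl (h1.trans hi), Or.inr ⟨k, by omega, h1.trans hi⟩]
  · refine Or.inr ⟨P, le_rfl, ?_⟩
    have h1 : h' ≤ (4 / ((P : ℝ) + 4) * A) ^ α + (4 / ((P : ℝ) + 4)) ^ 2 * H := by linarith
    calc h' * (((P + 1 : ℕ) + 2 : ℝ) * ((P + 1 : ℕ) + 3))
        ≤ ((4 / ((P : ℝ) + 4) * A) ^ α + (4 / ((P : ℝ) + 4)) ^ 2 * H) *
          (((P + 1 : ℕ) + 2 : ℝ) * ((P + 1 : ℕ) + 3)) :=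
          mul_le_mul_of_nonneg_right h1 (by positivity)
      _ = _ := by push_cast; ring

lemma GapInvariant.le_rateBound {α A H : ℝ} (hα1 : 1 ≤ α) (hα2 : α ≤ 2) (hA : 0 ≤ A)
    (hH : 0 ≤ H) {P : ℕ} (hP : 1 ≤ P) {h : ℝ} (hi : GapInvariant α A H P h) :
    h ≤ rateBound α A H (4 / ((P : ℝ) + 2)) := by
  have hP0 : (0 : ℝ) < (P + 2) * (P + 3) := by positivity
  rcases hi with hi | ⟨k, hk, hi⟩
  · refine le_trans ?_ (le_max_left _ _)
    rw [← le_div_iff₀ hP0] at hi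
    refine hi.trans ?_
    rw [mul_comm 12 H, mul_div_assoc, mul_comm H]
    refine mul_le_mul_of_nonneg_right ?_ hH
    -- For `P = 1` the base `4 / 3` exceeds one, so exponents cannot be compared through `α ≤ 2`;
    -- there the left side is exactly `1`.
    rcases hP.eq_or_lt with rfl | hP2
    · calc (12 : ℝ) / (((1 : ℕ) + 2) * ((1 : ℕ) + 3)) = 1 := by norm_num
        _ ≤ (4 / (((1 : ℕ) : ℝ) + 2)) ^ α :=
          Real.one_le_rpow (by norm_num) (by linarith)
    · have hP2' : (2 : ℝ) ≤ P := by exact_mod_cast hP2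
      calc (12 : ℝ) / ((P + 2) * (P + 3)) ≤ (4 / ((P : ℝ) + 2)) ^ (2 : ℝ) := by
            rw [Real.rpow_two, div_pow, div_le_div_iff₀ hP0 (by positivity)]
            nlinarith
        _ ≤ (4 / ((P : ℝ) + 2)) ^ α :=
            Real.rpow_le_rpow_of_exponent_ge (by positivity)
              (by rw [div_le_one (by positivity)]; linarith) hα2
  · refine le_trans ?_ (le_max_right _ _)
    have hX : 0 ≤ (4 / ((k : ℝ) + 4) * A) ^ α + (4 / ((k : ℝ) + 4)) ^ 2 * H := by positivity
    -- If `k + 1 = P` the products cancel. If `k + 2 ≤ P`, the ratio `r` is at most one, and `α ≤ 2`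
    -- gives `r ^ 2 ≤ r ^ α`, which rescales the threshold term from step `k`.
    rcases hk.eq_or_lt with rfl | hk2
    · push_cast at hi hP0 ⊢
      have h1 : h ≤ (4 / ((k : ℝ) + 4) * A) ^ α + (4 / ((k : ℝ) + 4)) ^ 2 * H := by
        refine le_of_mul_le_mul_right (hi.trans_eq ?_) hP0
        ring
      have h2 : 4 / ((k : ℝ) + 4) ≤ 4 / ((k : ℝ) + 1 + 2) :=
        div_le_div_of_nonneg_left (by norm_num) (by positivity) (by linarith)
      refine h1.trans ?_
      gcongr
    · have hk' : (k : ℝ) + 2 ≤ P := by exact_mod_cast hk2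
      set r : ℝ := ((k : ℝ) + 4) / (P + 2) with hr
      have hr0 : 0 < r := by positivity
      have hr1 : r ≤ 1 := by rw [hr, div_le_one (by positivity)]; linarith
      have hre : r * (4 / ((k : ℝ) + 4)) = 4 / ((P : ℝ) + 2) := by
        rw [hr]; field_simp
      have hle : h ≤ r ^ 2 * ((4 / ((k : ℝ) + 4) * A) ^ α + (4 / ((k : ℝ) + 4)) ^ 2 * H) := by
        rw [← le_div_iff₀ hP0, mul_div_right_comm] at hi
        refine hi.trans (mul_le_mul_of_nonneg_right ?_ hX)
        rw [hr, div_pow, div_le_div_iff₀ hP0 (by positivity)]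
        have : ((k : ℝ) + 3) * (P + 2) ≤ (k + 4) * (P + 3) := by nlinarith
        nlinarith [mul_le_mul_of_nonneg_left this
          (show (0 : ℝ) ≤ (k + 4) * (P + 2) by positivity)]
      refine hle.trans ?_
      have h2 : r ^ 2 ≤ r ^ α := by
        rw [← Real.rpow_two]
        exact Real.rpow_le_rpow_of_exponent_ge hr0 hr1 hα2
      rw [← hre, mul_assoc r, Real.mul_rpow hr0.le (by positivity), mul_pow, mul_add,
        mul_assoc (r ^ 2)]
      gcongr

/-! ### The primal gap along a run -/

section Gap

variable {C : Set (E d)} {f : E d → ℝ} {g : E d → E d} {L : ℝ}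

/-- The geometric Hölder error bound. -/
lemma mul_gap_le (hC : IsPolytope C) {μ θ : ℝ} (hconv : ConvexOn ℝ C f)
    (hsmooth : IsSmoothOn C f g L) (hHEB : HolderErrorBound C f μ θ) {z : E d}
    (hz : z ∈ minimizers C f) {x p q : E d} {S : Finset (E d)} (hx : x ∈ C)
    (hS : IsActiveSet (vertices C) x S)
    (hp : ∀ v ∈ C, inner ℝ (g x) (p - x) ≤ inner ℝ (g x) (v - x))
    (hq : ∀ v ∈ S, inner ℝ (g x) (v - x) ≤ inner ℝ (g x) (q - x))
    (hpq : 0 ≤ inner ℝ (g x) (q - p)) (hpos : 0 < f x - f z) :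
    pyramidalWidth C * (f x - f z) ≤ μ * (f x - f z) ^ θ * inner ℝ (g x) (q - p) := by
  have hdist : ∀ y ∈ minimizers C f,
      pyramidalWidth C * (f x - f z) ≤ inner ℝ (g x) (q - p) * dist x y := by
    intro y hy
    have hyz : f y = f z := le_antisymm (hy.2 hz.1) (hz.2 hy.1)
    have h1 := inner_gradient_le_sub hconv hx hy.1 (hsmooth.c1.hasGradient x hx)
    have h2 : f x - f z ≤ inner ℝ (-g x) (y - x) := by
      rw [inner_neg_left]; linarith
    have h3 := pyramidalWidth_mul_inner_le hC (r := -g x) hx hS (M := inner ℝ (g x) (q - p))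
      (fun s hs v hv => by
        have h4 := hp s hs
        have h5 := hq v hv
        simp only [inner_neg_left, inner_sub_right] at h4 h5 ⊢
        linarith) hy.1 (hpos.trans_le h2)
    rw [dist_eq_norm, norm_sub_rev]
    exact (mul_le_mul_of_nonneg_left h2 (pyramidalWidth_nonneg C)).trans h3
  rcases hpq.eq_or_lt with h0 | hG
  · have := hdist z hz
    rw [← h0, zero_mul] at this
    rw [← h0, mul_zero]
    exact this
  · have h1 : pyramidalWidth C * (f x - f z) / inner ℝ (g x) (q - p) ≤
        Metric.infDist x (minimizers C f) := by
      rw [Metric.le_infDist ⟨z, hz⟩]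
      intro y hy
      rw [div_le_iff₀ hG, mul_comm (dist x y)]
      exact hdist y hy
    rw [← div_le_iff₀ hG]
    exact h1.trans (hHEB x hx z hz)

namespace IsRun

variable {δ : ℝ} {η : ℕ → ℝ} {x : ℕ → E d} {S : ℕ → Finset (E d)} {lam : ℕ → E d → ℝ}
  {ℓ : ℕ → ℕ} {pFW pA : ℕ → E d} {γ : ℕ → ℝ}

lemma inner_pA_nonneg (h : IsRun C g L δ η x S lam ℓ pFW pA γ) {t : ℕ}
    (hw : HasWeights C x S lam t) : 0 ≤ inner ℝ (g (x t)) (pA t - x t) := by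
  obtain ⟨-, hpos, h1, hx⟩ := hw
  have hsum : ∑ v ∈ S t, lam t v • (v - x t) = 0 := by
    simp_rw [smul_sub, Finset.sum_sub_distrib, ← Finset.sum_smul, h1, hx, one_smul, sub_self]
  calc (0 : ℝ) = ∑ v ∈ S t, lam t v * inner ℝ (g (x t)) (v - x t) := by
        rw [← inner_zero_right (𝕜 := ℝ) (g (x t)), ← hsum, inner_sum]
        simp_rw [real_inner_smul_right]
    _ ≤ ∑ v ∈ S t, lam t v * inner ℝ (g (x t)) (pA t - x t) :=
        Finset.sum_le_sum fun v hv => mul_le_mul_of_nonneg_left (h.pA_max t v hv) (hpos v hv).le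
    _ = inner ℝ (g (x t)) (pA t - x t) := by rw [← Finset.sum_mul, h1, one_mul]

/-- The descent guaranteed by smoothness. -/
lemma exists_descent (h : IsRun C g L δ η x S lam ℓ pFW pA γ) (hC : IsPolytope C)
    (hδ : δ = Metric.diam C) (hsmooth : IsSmoothOn C f g L)
    (hη0 : ∀ n, 0 < η n) (hη1 : ∀ n, η n ≤ 1) (t : ℕ) :
    ∃ D : ℝ, inner ℝ (g (x t)) (x t - pFW t) ≤ D ∧
      inner ℝ (g (x t)) (pA t - pFW t) ≤ 2 * D ∧
      f (x (t + 1)) ≤ f (x t) - γ t * D + γ t ^ 2 * (L * δ ^ 2 / 2) := by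
  have hw := h.hasWeights hC.convex hη0 hη1
  have hxC : ∀ t, x t ∈ C := fun t => (hw t).mem hC.convex
  have hnorm : ∀ y ∈ C, ∀ z ∈ C, ‖y - z‖ ≤ δ := fun y hy z hz => by
    rw [← dist_eq_norm, hδ]
    exact Metric.dist_le_diam_of_mem hC.isCompact.isBounded hy hz
  have hdesc : ∀ e : E d, x (t + 1) = x t + γ t • e → ‖e‖ ≤ δ →
      f (x (t + 1)) ≤ f (x t) - γ t * (-inner ℝ (g (x t)) e) + γ t ^ 2 * (L * δ ^ 2 / 2) := by
    intro e he hle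
    have h1 := hsmooth.upper_bound (x t) (hxC t) (x (t + 1)) (hxC _)
    have h2 : x (t + 1) - x t = γ t • e := by rw [he]; abel
    rw [h2, real_inner_smul_right, norm_smul, mul_pow, Real.norm_eq_abs, sq_abs] at h1
    have h3 : ‖e‖ ^ 2 ≤ δ ^ 2 := by gcongr
    have h4 := mul_le_mul_of_nonneg_left h3
      (show 0 ≤ L / 2 * γ t ^ 2 from mul_nonneg (half_pos hsmooth.pos).le (sq_nonneg _))
    linarith
  have hpC := extremePoints_subset (h.pFW_mem t)
  have hqC := extremePoints_subset ((hw t).1 (h.pA_mem t))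
  by_cases hfw : TakesFWStep (g (x t)) (x t) (pFW t) (pA t)
  -- `D` is `-⟪∇f, d_t⟫`. The direction test makes it the larger of two quantities summing to `G`,
  -- hence at least `G / 2`.
  · refine ⟨_, ?_, ?_, hdesc _ (h.fw_x t hfw) (hnorm _ hpC _ (hxC t))⟩ <;>
    · unfold TakesFWStep at hfw
      simp only [inner_sub_right] at hfw ⊢
      linarith
  · refine ⟨_, ?_, ?_, hdesc _ (h.away_x t hfw) (hnorm _ (hxC t) _ hqC)⟩ <;>
    · unfold TakesFWStep at hfw
      simp only [inner_sub_right] at hfw ⊢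
      linarith

/-- The first step is a full Frank-Wolfe step. -/
lemma takesFWStep_zero (h : IsRun C g L δ η x S lam ℓ pFW pA γ) :
    TakesFWStep (g (x 0)) (x 0) (pFW 0) (pA 0) := by
  have hpA : pA 0 = x 0 := by simpa [h.S_zero] using h.pA_mem 0
  unfold TakesFWStep
  rw [hpA]
  simpa using h.inner_gradient_pFW_nonpos (extremePoints_subset h.x_zero)

/-- Steps that make no progress do not increase the objective, while progress steps satisfy a
perturbed descent and, for a large strong Wolfe gap, contract the primal gap. -/
lemma step_cases (h : IsRun C g L δ η x S lam ℓ pFW pA γ) (hC : IsPolytope C)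
    (hδ : δ = Metric.diam C) (hconv : ConvexOn ℝ C f) (hsmooth : IsSmoothOn C f g L)
    (hη0 : ∀ n, 0 < η n) (hη1 : ∀ n, η n ≤ 1) {z : E d} (hz : z ∈ minimizers C f) (t : ℕ) :
    (ℓ (t + 1) = ℓ t ∧ f (x (t + 1)) - f z ≤ f (x t) - f z) ∨
    (ℓ (t + 1) = ℓ t + 1 ∧
      f (x (t + 1)) - f z ≤ f (x t) - f z + η (ℓ t) ^ 2 * (L * δ ^ 2 / 2) ∧
      (η (ℓ t) * (2 * L * δ ^ 2) < inner ℝ (g (x t)) (pA t - pFW t) →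
        f (x (t + 1)) - f z ≤ (1 - η (ℓ t) / 2) * (f (x t) - f z))) := by
  have hw := h.hasWeights hC.convex hη0 hη1 t
  have hxC := hw.mem hC.convex
  obtain ⟨D, hD1, hD2, hdesc⟩ := h.exists_descent hC hδ hsmooth hη0 hη1 t
  have hγ0 := h.γ_nonneg hC.convex hη0 hw
  have hγ1 := h.γ_le t
  have hη := hη0 (ℓ t)
  have hgap : f (x t) - f z ≤ D := by
    have h1 := inner_gradient_le_sub hconv hxC hz.1 (hsmooth.c1.hasGradient _ hxC)
    have h2 := h.pFW_min t z hz.1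
    rw [← neg_sub (pFW t), inner_neg_right] at hD1
    linarith
  have hgap0 : 0 ≤ f (x t) - f z := sub_nonneg.2 (hz.2 hxC)
  have hLδ : 0 ≤ L * δ ^ 2 := mul_nonneg hsmooth.pos.le (sq_nonneg δ)
  have hD0 : 0 ≤ D := hgap0.trans hgap
  have hγD : 0 ≤ γ t * D := mul_nonneg hγ0 hD0
  set G := inner ℝ (g (x t)) (pA t - pFW t)
  have hℓ := h.ℓ_succ t
  split_ifs at hℓ with hprog
  · refine Or.inr ⟨hℓ, ?_, fun hG => ?_⟩
    · have : γ t ^ 2 * (L * δ ^ 2 / 2) ≤ η (ℓ t) ^ 2 * (L * δ ^ 2 / 2) := by gcongr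
      linarith
    · rcases hγ1.eq_or_lt with heq | hlt
      -- Half of `η D` gives the contraction through `D ≥ h`; the other half is at least `η G / 4`
      -- and absorbs `η² L δ² / 2`.
      · rw [heq] at hdesc
        nlinarith [mul_le_mul_of_nonneg_left hgap hη.le,
          mul_le_mul_of_nonneg_left (hG.le.trans hD2) hη.le]
      -- A shortened progress step has `G ≤ (η + γ) L δ² ≤ 2 η L δ²`, against `hG`.
      · exfalso
        have h1 : (η (ℓ t) - γ t) * G ≤ (η (ℓ t) - γ t) * ((η (ℓ t) + γ t) * (L * δ ^ 2)) := by
          linarith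
        have h2 := le_of_mul_le_mul_left h1 (sub_pos.2 hlt)
        nlinarith [mul_le_mul_of_nonneg_right hγ1 hLδ]
  · refine Or.inl ⟨hℓ, ?_⟩
    push Not at hprog
    -- Failure of the test means `G > (η + γ) L δ² ≥ 2 γ L δ²`, so the linear decrease beats the
    -- quadratic term.
    have h1 : (η (ℓ t) - γ t) * ((η (ℓ t) + γ t) * (L * δ ^ 2)) < (η (ℓ t) - γ t) * G := by
      linarith
    have h2 := lt_of_mul_lt_mul_left h1 (sub_nonneg.2 hγ1)
    have h3 : γ t * (L * δ ^ 2 / 2) ≤ D := by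
      nlinarith [mul_le_mul_of_nonneg_right hγ1 hLδ, mul_nonneg hγ0 hLδ]
    nlinarith [mul_le_mul_of_nonneg_left h3 hγ0]

/-- The strong Wolfe gap is large when the primal gap is large. -/
lemma lt_inner_of_lt_gap (h : IsRun C g L δ η x S lam ℓ pFW pA γ) (hC : IsPolytope C)
    {μ θ : ℝ} (hμ : 0 < μ) (hθ : θ < 1) (hω : 0 < pyramidalWidth C)
    (hconv : ConvexOn ℝ C f) (hsmooth : IsSmoothOn C f g L) (hHEB : HolderErrorBound C f μ θ)
    (hη0 : ∀ n, 0 < η n) (hη1 : ∀ n, η n ≤ 1) {z : E d} (hz : z ∈ minimizers C f) {t : ℕ}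
    {e : ℝ} (he : 0 ≤ e)
    (hlt : (e * (2 * μ * L * δ ^ 2 / pyramidalWidth C)) ^ (1 / (1 - θ)) < f (x t) - f z) :
    e * (2 * L * δ ^ 2) < inner ℝ (g (x t)) (pA t - pFW t) := by
  have hw := h.hasWeights hC.convex hη0 hη1 t
  have hxC := hw.mem hC.convex
  have hL := hsmooth.pos
  set ω := pyramidalWidth C
  set B := e * (2 * μ * L * δ ^ 2 / ω)
  have hB : 0 ≤ B := by positivity
  have hθ' : 0 < 1 - θ := sub_pos.2 hθ
  have hpos : 0 < f (x t) - f z := (Real.rpow_nonneg hB _).trans_lt hlt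
  have hG0 : 0 ≤ inner ℝ (g (x t)) (pA t - pFW t) := by
    have h1 := h.inner_pA_nonneg hw
    have h2 := h.inner_gradient_pFW_nonpos hxC
    rw [← sub_sub_sub_cancel_right _ _ (x t), inner_sub_right]
    linarith
  have hkey := mul_gap_le hC hconv hsmooth hHEB hz hxC hw.isActiveSet (h.pFW_min t) (h.pA_max t)
    hG0 hpos
  set k := f (x t) - f z
  have hroot : B < k ^ (1 - θ) := by
    have := Real.rpow_lt_rpow (Real.rpow_nonneg hB _) hlt hθ'
    rwa [← Real.rpow_mul hB, one_div_mul_cancel hθ'.ne', Real.rpow_one] at this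
  have hkθ : 0 < k ^ θ := Real.rpow_pos_of_pos hpos θ
  have hsplit : k = k ^ θ * k ^ (1 - θ) := by
    rw [← Real.rpow_add hpos, add_sub_cancel, Real.rpow_one]
  have h1 : ω * k ^ (1 - θ) ≤ μ * inner ℝ (g (x t)) (pA t - pFW t) := by
    refine le_of_mul_le_mul_left ?_ hkθ
    calc k ^ θ * (ω * k ^ (1 - θ)) = ω * k := by
          conv_rhs => rw [hsplit]
          ring
      _ ≤ μ * k ^ θ * inner ℝ (g (x t)) (pA t - pFW t) := hkey
      _ = _ := by ring
  refine lt_of_mul_lt_mul_left (lt_of_lt_of_le ?_ h1) hμ.le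
  calc μ * (e * (2 * L * δ ^ 2)) = ω * B := by
        simp only [B]
        field_simp
    _ < ω * k ^ (1 - θ) := mul_lt_mul_of_pos_left hroot hω

end IsRun

end Gap

/-- The induction starts at `t = 1`: since `η_0 = 1`, the first step is a full Frank-Wolfe step, so
`h_1 ≤ H`. This is the source of `12 = (1 + 2)(1 + 3)` in the invariant. -/
lemma IsRun.gapInvariant {C : Set (E d)} {f : E d → ℝ} {g : E d → E d} {L δ μ θ : ℝ}
    {x : ℕ → E d} {S : ℕ → Finset (E d)} {lam : ℕ → E d → ℝ} {ℓ : ℕ → ℕ} {pFW pA : ℕ → E d}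
    {γ : ℕ → ℝ}
    (h : IsRun C g L δ (fun t : ℕ => stepSize (t : ℤ)) x S lam ℓ pFW pA γ) (hC : IsPolytope C)
    (hδ : δ = Metric.diam C) (hμ : 0 < μ) (hθ : θ < 1) (hω : 0 < pyramidalWidth C)
    (hconv : ConvexOn ℝ C f) (hsmooth : IsSmoothOn C f g L) (hHEB : HolderErrorBound C f μ θ)
    {z : E d} (hz : z ∈ minimizers C f) {t : ℕ} (ht : 1 ≤ t) :
    GapInvariant (1 / (1 - θ)) (2 * μ * L * δ ^ 2 / pyramidalWidth C) (L * δ ^ 2 / 2) (ℓ t)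
      (f (x t) - f z) := by
  have hη0 : ∀ n : ℕ, 0 < stepSize (n : ℤ) := fun n => stepSize_pos (by omega)
  have hη1 := stepSize_natCast_le_one
  induction t, ht using Nat.le_induction with
  | base =>
    have hfw := h.takesFWStep_zero
    have hγ : γ 0 = 1 := by
      rw [h.fw_γ_eq hη1 hfw, h.ℓ_zero]
      norm_num [stepSize]
    have hℓ : ℓ 1 = 1 := by
      have := h.ℓ_succ_of_γ_eq (h.fw_γ_eq hη1 hfw)
      rwa [h.ℓ_zero] at this
    obtain ⟨D, hD, -, hdesc⟩ := h.exists_descent hC hδ hsmooth hη0 hη1 0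
    have hx0 := extremePoints_subset h.x_zero
    have h1 := inner_gradient_le_sub hconv hx0 hz.1 (hsmooth.c1.hasGradient _ hx0)
    have h2 := h.pFW_min 0 z hz.1
    rw [← neg_sub (pFW 0), inner_neg_right] at hD
    rw [hγ, one_mul, one_pow, one_mul, zero_add] at hdesc
    refine Or.inl ?_
    rw [hℓ]
    push_cast
    linarith
  | succ t ht ih =>
    rcases h.step_cases hC hδ hconv hsmooth hη0 hη1 hz t with ⟨hℓ, hle⟩ | ⟨hℓ, hle, hcontr⟩
    · rw [hℓ]
      exact ih.mono hle
    · rw [hℓ]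
      simp only [stepSize_natCast] at hle hcontr
      exact ih.succ hle fun hlt => hcontr
        (h.lt_inner_of_lt_gap hC hμ hθ hω hconv hsmooth hHEB hη0 hη1 hz (by positivity) hlt)

lemma rateBound_le {α A H : ℝ} (hα2 : α ≤ 2) (hA : 0 ≤ A) (hH : 0 ≤ H)
    {t : ℝ} (ht : 8 ≤ t) :
    rateBound α A H (8 / t) ≤ 8 ^ α * (H + A ^ α) * (1 / t ^ α) := by
  have ht0 : 0 < t := by linarith
  have he1 : 8 / t ≤ 1 := by rwa [div_le_one ht0]
  have hpow : (8 / t) ^ 2 ≤ (8 / t) ^ α := by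
    rw [← Real.rpow_two]
    exact Real.rpow_le_rpow_of_exponent_ge (by positivity) he1 hα2
  have heq : 8 ^ α * (H + A ^ α) * (1 / t ^ α) = (8 / t) ^ α * (H + A ^ α) := by
    rw [Real.div_rpow (by norm_num) ht0.le]
    ring
  rw [heq, rateBound, Real.mul_rpow (by positivity) hA, mul_add]
  refine max_le ?_ ?_
  · linarith [show 0 ≤ (8 / t) ^ α * A ^ α by positivity]
  · linarith [mul_le_mul_of_nonneg_right hpow hH]

end AFW

theorem mainTheorem6 {d : ℕ} (C : Set (AFW.E d)) (hC : AFW.IsPolytope C)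
    (δ ω : ℝ) (hδ : δ = Metric.diam C) (hδ_pos : 0 < δ)
    (hω : ω = AFW.pyramidalWidth C) (hω_pos : 0 < ω)
    (f : AFW.E d → ℝ) (g : AFW.E d → AFW.E d) (L μ θ : ℝ)
    (hconv : ConvexOn ℝ C f) (hsmooth : AFW.IsSmoothOn C f g L)
    (hμ : 0 < μ) (hθ : θ ∈ Set.Icc (0 : ℝ) (1 / 2))
    (hHEB : AFW.HolderErrorBound C f μ θ)
    (xstar : AFW.E d) (hxstar : xstar ∈ AFW.minimizers C f)
    (x : ℕ → AFW.E d) (S : ℕ → Finset (AFW.E d)) (lam : ℕ → AFW.E d → ℝ) (ℓ : ℕ → ℕ)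
    (pFW pA : ℕ → AFW.E d) (γ : ℕ → ℝ)
    (hrun : AFW.IsRun C g L δ (fun t : ℕ => AFW.stepSize (t : ℤ)) x S lam ℓ pFW pA γ) :
    (∀ t : ℕ, 1 ≤ t →
      f (x t) - f xstar ≤
        max (AFW.stepSize ⌈(t : ℝ) / 2 - 2⌉ ^ (1 / (1 - θ)) * (L * δ ^ 2 / 2))
          ((AFW.stepSize ⌈(t : ℝ) / 2 - 2⌉ * 2 * μ * L * δ ^ 2 / ω) ^ (1 / (1 - θ)) +
            AFW.stepSize ⌈(t : ℝ) / 2 - 2⌉ ^ 2 * (L * δ ^ 2 / 2))) ∧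
    (fun t : ℕ => f (x t) - f xstar) =O[atTop]
      (fun t : ℕ => (1 / (t : ℝ) ^ (1 / (1 - θ)))) := by
  have hL := hsmooth.pos
  have hθ1 : 0 < 1 - θ := by linarith [hθ.2]
  have hα1 : 1 ≤ 1 / (1 - θ) := by
    rw [le_div_iff₀ hθ1]
    linarith [hθ.1]
  have hα2 : 1 / (1 - θ) ≤ 2 := by
    rw [div_le_iff₀ hθ1]
    linarith [hθ.2]
  have hη0 : ∀ n : ℕ, 0 < AFW.stepSize (n : ℤ) := fun n => AFW.stepSize_pos (by omega)
  have hη1 := AFW.stepSize_natCast_le_one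
  have hA : 0 ≤ 2 * μ * L * δ ^ 2 / ω := by positivity
  have hH : 0 ≤ L * δ ^ 2 / 2 := by positivity
  -- The index is at least `-1`, so the denominator of the step size stays positive.
  have hceil : ∀ t : ℕ, 1 ≤ t → -1 ≤ ⌈(t : ℝ) / 2 - 2⌉ := by
    intro t ht
    have ht' : (1 : ℝ) ≤ t := by exact_mod_cast ht
    rw [Int.le_ceil_iff]
    push_cast
    linarith
  have hbound : ∀ t : ℕ, 1 ≤ t → f (x t) - f xstar ≤
      AFW.rateBound (1 / (1 - θ)) (2 * μ * L * δ ^ 2 / ω) (L * δ ^ 2 / 2)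
        (AFW.stepSize ⌈(t : ℝ) / 2 - 2⌉) := by
    intro t ht
    have hℓ := hrun.le_two_mul_ℓ hC.convex hη0 hη1 t
    have hinv := hrun.gapInvariant hC hδ hμ (sub_pos.1 hθ1) (hω ▸ hω_pos) hconv hsmooth hHEB
      hxstar ht
    rw [← hω] at hinv
    refine (hinv.le_rateBound hα1 hα2 hA hH (by omega)).trans ?_
    -- The shift by two in the index arises here; `t ≤ 2 ℓ t` then gives `⌈t / 2 - 2⌉ ≤ ℓ t - 2`.
    have hstep : (4 : ℝ) / ((ℓ t : ℝ) + 2) = AFW.stepSize ((ℓ t : ℤ) - 2) := by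
      unfold AFW.stepSize
      push_cast
      congr 1
      ring
    have hle : ⌈(t : ℝ) / 2 - 2⌉ ≤ (ℓ t : ℤ) - 2 := by
      rw [Int.ceil_le]
      have : (t : ℝ) ≤ 2 * ℓ t := by exact_mod_cast hℓ
      push_cast
      linarith
    refine AFW.rateBound_mono (by linarith) hA hH (by positivity) ?_
    rw [hstep]
    exact AFW.stepSize_anti (hceil t ht) hle
  refine ⟨fun t ht => ?_, ?_⟩
  · have harg : AFW.stepSize ⌈(t : ℝ) / 2 - 2⌉ * 2 * μ * L * δ ^ 2 / ω =
        AFW.stepSize ⌈(t : ℝ) / 2 - 2⌉ * (2 * μ * L * δ ^ 2 / ω) := by ring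
    rw [harg]
    exact hbound t ht
  · refine IsBigO.of_bound
      (8 ^ (1 / (1 - θ)) * (L * δ ^ 2 / 2 + (2 * μ * L * δ ^ 2 / ω) ^ (1 / (1 - θ)))) ?_
    filter_upwards [eventually_ge_atTop 8] with t ht
    have ht' : (8 : ℝ) ≤ t := by exact_mod_cast ht
    have hnn : 0 ≤ f (x t) - f xstar :=
      sub_nonneg.2 (hxstar.2 ((hrun.hasWeights hC.convex hη0 hη1 t).mem hC.convex))
    rw [Real.norm_of_nonneg hnn, Real.norm_of_nonneg (by positivity)]
    refine (hbound t (by omega)).trans (le_trans ?_ (AFW.rateBound_le hα2 hA hH ht'))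
    -- The step size is at most `4 / (t / 2 + 2) ≤ 8 / t`.
    refine AFW.rateBound_mono (by linarith) hA hH (AFW.stepSize_pos (hceil t (by omega))).le ?_
    unfold AFW.stepSize
    have := Int.le_ceil ((t : ℝ) / 2 - 2)
    rw [div_le_div_iff₀ (by linarith) (by linarith)]
    linarith
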